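/- **Proposition (Poisson-binomial trials).** Let $n\ge 1$, let $X_1,\dots,X_n$ be independent Bernoulli random variables with $\mathbb P(X_i=1)=p_i\in(0,1)$, and set $$W=\sum_{i=1}^n X_i,\qquad \mu=\mathbb E W,\qquad \sigma^2=\mathrm{Var}(W),\qquad \mu_2=\sum_{i=1}^n p_i^2 .$$ For $\lambda>0$ let $\mathrm{Pn}(\lambda)$ be the Poisson distribution with mean $\lambda$, let $Y\sim \mathrm{Pn}(\lambda)$, $F(j)=\mathbb P(Y\le j)$, $\overline F(j)=\mathbb P(Y\ge j)$, and for a positive integer $k$ define $$C_1(\lambda,k)=\frac{F(k-1)}{k\,\mathbb P(Y=k)}\left\{1-\min\left(\frac{F(k-2)}{F(k-1)}\cdot\frac{\lambda}{k-1},\ \frac{\overline F(k+1)}{\overline F(k)}\cdot\frac{k}{\lambda}\right)\right\},$$ $$C_2(\lambda,k)=\frac{F(k-1)}{k\,\mathbb P(Y=k)}\left(2-\frac{F(k-2)}{F(k-1)}\cdot\frac{\lambda}{k-1}-\frac{\overline F(k+1)}{\overline F(k)}\cdot\frac{k}{\lambda}\right),$$ where for $k=1$ the (undefined) expression $\frac{F(k-2)}{F(k-1)}\cdot\frac{\lambda}{k-1}$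 is read as $1$. Then for every integer $k>\mu$, $$\left|\frac{\mathbb P(W\ge k)}{\mathrm{Pn}(\mu)([k,\infty))}-1\right|\le C_1(\mu,k)\,\mu_2 ,$$ and, with $a=\lfloor \mu_2\rfloor$ and $\lambda=\mu-a$, $$\left|\frac{\mathbb P(W-a\ge k)}{\mathrm{Pn}(\lambda)([k,\infty))}-1\right|\le \frac{C_2(\lambda,k)\sum_{i=1}^n p_i^2(1-p_i)}{1\vee\sqrt{\left(\sum_{i=1}^n \bigl(p_i\wedge(1-p_i)\bigr)-\tfrac14\right)\tfrac{\pi}{2}}}+C_1(\lambda,k)\,|\lambda-\sigma^2|+e^{-(\lambda+2)^2/(2\mu)} ,$$ where the denominator is read as $1$ if the quantity under the square root is negative. -/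

import Mathlib

open MeasureTheory ProbabilityTheory

noncomputable section

namespace PoissonBinomial

/-- `P(Y ∈ A)` for `Y ∼ Pn(lam)` and a set `A` of integers, where `lam > 0`. -/
def pn (lam : ℝ) (A : Set ℤ) : ℝ :=
  (poissonMeasure lam.toNNReal).real {y : ℕ | (y : ℤ) ∈ A}

/-- `F(j) = P(Y ≤ j)`. -/
def F (lam : ℝ) (j : ℤ) : ℝ := pn lam (Set.Iic j)

/-- `F̄(j) = P(Y ≥ j)`. -/
def Fbar (lam : ℝ) (j : ℤ) : ℝ := pn lam (Set.Ici j)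

/-- The factor `F(k-1) / (k P(Y = k))`. -/
def C0 (lam : ℝ) (k : ℤ) : ℝ := F lam (k - 1) / (k * pn lam {k})

/-- `(F(k-2) / F(k-1)) * (lam / (k-1))`. For `k = 1` this expression is undefined; it is read
as `1`, so that `C0 lam 1 * (1 - lowerTerm lam 1) = 0`. -/
def lowerTerm (lam : ℝ) (k : ℤ) : ℝ :=
  if k = 1 then 1 else F lam (k - 2) / F lam (k - 1) * (lam / (k - 1))

/-- `(F̄(k+1) / F̄(k)) * (k / lam)`. -/
def upperTerm (lam : ℝ) (k : ℤ) : ℝ := Fbar lam (k + 1) / Fbar lam k * (k / lam)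

/-- The constant `C₁(lam, k)`, for `lam > 0` and a positive integer `k`. -/
def C1 (lam : ℝ) (k : ℤ) : ℝ := C0 lam k * (1 - min (lowerTerm lam k) (upperTerm lam k))

/-- The constant `C₂(lam, k)`, for `lam > 0` and a positive integer `k`. -/
def C2 (lam : ℝ) (k : ℤ) : ℝ := C0 lam k * (2 - lowerTerm lam k - upperTerm lam k)

end PoissonBinomial

end

/-! This is the Stein–Chen method. A solution `f` of the Poisson Stein equation for the indicator of
`[k, ∞)` turns the tail discrepancy into an expectation involving `f` (`tail_sub_eq`). Below `k` the
solution is a multiple of a Laplace-type integral, above `k` of a beta-type integral. Monotonicity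
of their increments shows that the extreme steps of `f` lie on either side of `k`; these steps,
divided by the tail, give `C1` as the larger size and `C2` as their sum (`exists_stein_solution`).

Expectations over Bernoulli sums are polynomials in the shift, so the Stein operator expands by ring
algebra (`stein_polynomial_one`, `stein_polynomial_two`). First differences give the first bound. In
the second bound a second difference is paid for by the smoothness of the sum without one summand
(`abs_act_prod_bern_le`): each Bernoulli variable is a mixture of a constant and a fair coin, and a
binomial with `N` fair coins changes by order `1/√(N+1)` under a unit shift.

For `k ≥ 2` the Stein equation holds on all integers, so negative values of `W - a` cost nothing;
for `k = 1` the shift `a` is zero. The exponential term is therefore only slack. -/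

noncomputable section

namespace PoissonBinomial

/-! ### Polynomials in the shift, and smoothness of symmetric binomials -/

section ShiftOperators

open Polynomial

/-- The shift `φ ↦ φ (· + 1)` on functions on the integers. -/
def shift : (ℤ → ℝ) →ₗ[ℝ] (ℤ → ℝ) := LinearMap.funLeft ℝ ℝ (· + 1)

/-- The action of a polynomial in the shift: if `R` is the generating polynomial of `S`, then
`act R φ x` is the expectation of `φ (x + S)`. -/
def act (R : ℝ[X]) (φ : ℤ → ℝ) (x : ℤ) : ℝ := aeval shift R φ x

/-- The generating polynomial of a Bernoulli variable. -/
def bern (p : ℝ) : ℝ[X] := C (1 - p) + C p * X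

lemma act_add (R S : ℝ[X]) (φ : ℤ → ℝ) (x : ℤ) : act (R + S) φ x = act R φ x + act S φ x := by
  simp [act]

lemma act_sub (R S : ℝ[X]) (φ : ℤ → ℝ) (x : ℤ) : act (R - S) φ x = act R φ x - act S φ x := by
  simp [act]

lemma act_C_mul (c : ℝ) (R : ℝ[X]) (φ : ℤ → ℝ) (x : ℤ) : act (C c * R) φ x = c * act R φ x := by
  simp [act, aeval_C]

lemma act_one (φ : ℤ → ℝ) (x : ℤ) : act 1 φ x = φ x := by simp [act]

lemma act_mul (R S : ℝ[X]) (φ : ℤ → ℝ) (x : ℤ) : act (R * S) φ x = act R (act S φ) x := by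
  simp only [act, map_mul, Module.End.mul_apply]
  rfl

lemma act_X (φ : ℤ → ℝ) (x : ℤ) : act X φ x = φ (x + 1) := by
  simp [act, shift, LinearMap.funLeft_apply]

lemma act_X_mul (R : ℝ[X]) (φ : ℤ → ℝ) (x : ℤ) : act (X * R) φ x = act R φ (x + 1) := by
  rw [act_mul, act_X]

lemma act_sum {ι : Type*} (s : Finset ι) (R : ι → ℝ[X]) (φ : ℤ → ℝ) (x : ℤ) :
    act (∑ i ∈ s, R i) φ x = ∑ i ∈ s, act (R i) φ x := by
  simp [act, map_sum, LinearMap.sum_apply, Finset.sum_apply]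

lemma act_add_right (R : ℝ[X]) (φ ψ : ℤ → ℝ) (x : ℤ) :
    act R (fun y => φ y + ψ y) x = act R φ x + act R ψ x := by
  have : (fun y => φ y + ψ y) = φ + ψ := rfl
  simp [act, this]

lemma act_sub_right (R : ℝ[X]) (φ ψ : ℤ → ℝ) (x : ℤ) :
    act R (fun y => φ y - ψ y) x = act R φ x - act R ψ x := by
  have : (fun y => φ y - ψ y) = φ - ψ := rfl
  simp [act, this]

lemma act_mul_right (R : ℝ[X]) (c : ℝ) (φ : ℤ → ℝ) (x : ℤ) :
    act R (fun y => c * φ y) x = c * act R φ x := by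
  have : (fun y => c * φ y) = c • φ := rfl
  simp [act, this]

lemma act_X_sub_one (φ : ℤ → ℝ) (x : ℤ) : act (X - 1) φ x = φ (x + 1) - φ x := by
  rw [act_sub, act_X, act_one]

lemma act_mul_X_sub_one (R : ℝ[X]) (φ : ℤ → ℝ) (x : ℤ) :
    act (R * (X - 1)) φ x = act R (fun y => φ (y + 1) - φ y) x := by
  rw [act_mul]
  congr 1
  ext y
  exact act_X_sub_one φ y

lemma act_bern_mul (p : ℝ) (R : ℝ[X]) (φ : ℤ → ℝ) (x : ℤ) :
    act (bern p * R) φ x = (1 - p) * act R φ x + p * act R φ (x + 1) := by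
  rw [bern, add_mul, act_add, act_C_mul, mul_assoc, act_C_mul, act_X_mul]

/-- The Euler operator multiplies `X ^ n` by `n`, which is the displacement produced by that power
of the shift. -/
lemma act_id_mul (R : ℝ[X]) (φ : ℤ → ℝ) (x : ℤ) :
    act R (fun y => ((y : ℝ) - x) * φ y) x = act (X * derivative R) φ x := by
  induction R using Polynomial.induction_on' with
  | add p q hp hq => rw [act_add, hp, hq, derivative_add, mul_add, act_add]
  | monomial n a =>
    have key : ∀ (n : ℕ) (ψ : ℤ → ℝ) (x : ℤ), act (X ^ n) ψ x = ψ (x + n) := by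
      intro n ψ
      induction n with
      | zero => intro x; simp [act_one]
      | succ n ih => intro x; rw [pow_succ', act_X_mul, ih]; push_cast; congr 1; ring
    rw [derivative_monomial, ← C_mul_X_pow_eq_monomial, ← C_mul_X_pow_eq_monomial, act_C_mul, key,
      mul_left_comm X, act_C_mul]
    cases n with
    | zero => simp
    | succ n => rw [Nat.add_sub_cancel, ← pow_succ', key]; push_cast; ring

/-- Averaging operators: those that are monotone and fix constants. -/
def IsAvg (R : ℝ[X]) : Prop :=
  (∀ c x, act R (fun _ => c) x = c) ∧ ∀ φ ψ x, (∀ y, φ y ≤ ψ y) → act R φ x ≤ act R ψ x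

lemma isAvg_one : IsAvg 1 := ⟨fun c x => act_one _ _, fun φ ψ x h => by simpa [act_one] using h x⟩

lemma isAvg_bern_mul {p : ℝ} (h0 : 0 ≤ p) (h1 : p ≤ 1) {R : ℝ[X]} (hR : IsAvg R) :
    IsAvg (bern p * R) := by
  refine ⟨fun c x => ?_, fun φ ψ x h => ?_⟩
  · rw [act_bern_mul, hR.1, hR.1]; ring
  · rw [act_bern_mul, act_bern_mul]
    have := hR.2 φ ψ x h
    have := hR.2 φ ψ (x + 1) h
    have : 0 ≤ 1 - p := by linarith
    gcongr

lemma isAvg_prod {ι : Type*} (s : Finset ι) {p : ι → ℝ} (hp : ∀ i, 0 ≤ p i ∧ p i ≤ 1) :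
    IsAvg (∏ i ∈ s, bern (p i)) := by
  classical
  induction s using Finset.induction_on with
  | empty => simpa using isAvg_one
  | insert i s hi ih => rw [Finset.prod_insert hi]; exact isAvg_bern_mul (hp i).1 (hp i).2 ih

lemma isAvg_pow (N : ℕ) : IsAvg (bern (1 / 2) ^ N) := by
  have := isAvg_prod (Finset.range N) (p := fun _ => 1 / 2) (fun _ => by norm_num)
  simpa using this

lemma IsAvg.abs_le {R : ℝ[X]} (hR : IsAvg R) {φ : ℤ → ℝ} {c : ℝ} (h : ∀ y, |φ y| ≤ c) (x : ℤ) :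
    |act R φ x| ≤ c := by
  rw [_root_.abs_le]
  constructor
  · rw [← hR.1 (-c) x]; exact hR.2 _ _ _ fun y => (_root_.abs_le.1 (h y)).1
  · rw [← hR.1 c x]; exact hR.2 _ _ _ fun y => (_root_.abs_le.1 (h y)).2

/-- With `B = bern (1 / 2)` one has `B' = 1/2`, so the weight produces `(N + 1) (X - B) B ^ N`, and
`X - B = (X - 1) / 2`. -/
lemma act_half_pow_score (N : ℕ) (φ : ℤ → ℝ) (x : ℤ) :
    act (bern (1 / 2) ^ (N + 1)) (fun y => (2 * ((y : ℝ) - x) - (N + 1)) * φ y) x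
      = (N + 1) / 2 * act ((X - 1) * bern (1 / 2) ^ N) φ x := by
  have h : (fun y : ℤ => (2 * ((y : ℝ) - x) - (N + 1)) * φ y)
      = fun y : ℤ => 2 * (((y : ℝ) - x) * φ y) - (N + 1) * φ y := by ext y; ring
  rw [h, act_sub_right, act_mul_right, act_mul_right, act_id_mul, ← act_C_mul, ← act_C_mul,
    ← act_C_mul, ← act_sub]
  congr 1
  have hb : derivative (bern (1 / 2)) = C (1 / 2) := by simp [bern]
  have e2 : (C (2 : ℝ) : ℝ[X]) = 2 := map_ofNat C 2
  have e3 : (C ((N : ℝ) + 1) : ℝ[X]) = N + 1 := by simp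
  have e4 : (C (((N : ℝ) + 1) / 2) : ℝ[X]) = (N + 1) * C (1 / 2 : ℝ) := by
    rw [← e3, ← C_mul, div_eq_mul_one_div]
  have e5 : (C (1 - 1 / 2 : ℝ) : ℝ[X]) = C (1 / 2) := by norm_num
  rw [derivative_pow, hb, e2, e4]
  have e6 : (C (((N + 1 : ℕ) : ℝ)) : ℝ[X]) = N + 1 := by simp
  rw [e6, e3, Nat.add_sub_cancel, pow_succ]
  generalize hB : bern (1 / 2) ^ N = Q
  rw [bern, e5]
  ring

/-- The score identity is applied to the score itself, whose increments are constantly 2. -/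
lemma act_half_pow_variance (N : ℕ) (x : ℤ) :
    act (bern (1 / 2) ^ (N + 1)) (fun y => (2 * ((y : ℝ) - x) - (N + 1)) ^ 2) x = N + 1 := by
  simp only [pow_two (2 * (_ : ℝ) - _)]
  rw [act_half_pow_score, mul_comm (X - 1), act_mul_X_sub_one]
  have : (fun y : ℤ => 2 * (((y + 1 : ℤ) : ℝ) - x) - ((N : ℝ) + 1) - (2 * ((y : ℝ) - x) - (N + 1)))
      = fun _ => 2 := by ext y; push_cast; ring
  rw [this, (isAvg_pow N).1]
  ring

/-- Smoothness of the symmetric binomial distribution. -/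
lemma abs_act_half_pow_le (N : ℕ) {φ : ℤ → ℝ} {c : ℝ} (h : ∀ y, |φ y| ≤ c) (x : ℤ) :
    |act ((X - 1) * bern (1 / 2) ^ N) φ x| ≤ 2 * c * √(1 / (N + 1)) := by
  set M : ℝ := N + 1 with hM
  have hM0 : 0 < M := by positivity
  have hc : 0 ≤ c := (abs_nonneg _).trans (h 0)
  set r := √M with hr
  have hr0 : 0 < r := Real.sqrt_pos.2 hM0
  have hrM : r * r = M := Real.mul_self_sqrt hM0.le
  have hav := isAvg_pow (N + 1)
  set u : ℤ → ℝ := fun y => 2 * ((y : ℝ) - x) - M with hu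
  -- AM-GM with `r = √M` replaces Cauchy–Schwarz: as `u ^ 2` has mean `M`, the right side averages
  -- to `c * r`.
  have hb : ∀ y, |u y * φ y| ≤ c / (2 * r) * u y ^ 2 + c * r / 2 := by
    intro y
    have h2 : |u y| ≤ 1 / (2 * r) * u y ^ 2 + r / 2 := by
      rw [← sq_abs (u y)]
      have : 1 / (2 * r) * |u y| ^ 2 + r / 2 - |u y| = (|u y| - r) ^ 2 / (2 * r) := by
        field_simp; ring
      have h3 : 0 ≤ (|u y| - r) ^ 2 / (2 * r) := by positivity
      linarith
    rw [abs_mul]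
    calc |u y| * |φ y| ≤ (1 / (2 * r) * u y ^ 2 + r / 2) * c :=
          mul_le_mul h2 (h y) (abs_nonneg _) (by positivity)
      _ = _ := by ring
  have hv : act (bern (1 / 2) ^ (N + 1)) (fun y => c / (2 * r) * u y ^ 2 + c * r / 2) x = c * r := by
    rw [act_add_right, act_mul_right, hav.1, act_half_pow_variance, ← hM, ← hrM]
    field_simp; ring
  have hs := act_half_pow_score N φ x
  have h4 : |act (bern (1 / 2) ^ (N + 1)) (fun y => u y * φ y) x| ≤ c * r := by
    rw [← hv, _root_.abs_le]
    constructor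
    · have := hav.2 (fun y => -1 * (c / (2 * r) * u y ^ 2 + c * r / 2)) (fun y => u y * φ y) x
        fun y => by linarith [(_root_.abs_le.1 (hb y)).1]
      rw [act_mul_right] at this
      linarith
    · exact hav.2 _ _ x fun y => (_root_.abs_le.1 (hb y)).2
  rw [hs, abs_mul, ← hM, abs_of_pos (by positivity), ← hrM] at h4
  rw [Real.sqrt_div zero_le_one, Real.sqrt_one, ← hr, mul_one_div, le_div_iff₀ hr0]
  nlinarith

end ShiftOperators

/-! ### Smoothness of Poisson-binomial laws through fair coins -/

section Smoothing

open Polynomial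

/-- The squared smoothness bound for a mixture of symmetric binomial distributions. -/
def smoothBound (N : ℕ) (κ : ℝ) : ℝ := ∫ s in (0 : ℝ)..1, s ^ N * Real.exp (-κ * (1 - s))

/-- Adding a fair coin with probability `q` multiplies the integrand by `1 - q (1 - s)`, which is at
most `exp (-q (1 - s))`. -/
lemma smoothBound_step (N : ℕ) (κ : ℝ) (q : ℝ) :
    (1 - q) * smoothBound N κ + q * smoothBound (N + 1) κ ≤ smoothBound N (κ + q) := by
  rw [smoothBound, smoothBound, smoothBound, ← intervalIntegral.integral_const_mul,
    ← intervalIntegral.integral_const_mul, ← intervalIntegral.integral_add]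
  · apply intervalIntegral.integral_mono_on zero_le_one
    · exact Continuous.intervalIntegrable (by fun_prop) _ _
    · exact Continuous.intervalIntegrable (by fun_prop) _ _
    · intro s hs
      have h1 : Real.exp (-(κ + q) * (1 - s))
          = Real.exp (-κ * (1 - s)) * Real.exp (-(q * (1 - s))) := by
        rw [← Real.exp_add]; ring_nf
      have h2 : 1 - q * (1 - s) ≤ Real.exp (-(q * (1 - s))) := by
        linarith [Real.add_one_le_exp (-(q * (1 - s)))]
      have h3 : 0 ≤ s ^ N * Real.exp (-κ * (1 - s)) := mul_nonneg (pow_nonneg hs.1 _) (Real.exp_nonneg _)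
      rw [h1]
      calc _ = s ^ N * Real.exp (-κ * (1 - s)) * (1 - q * (1 - s)) := by ring
        _ ≤ s ^ N * Real.exp (-κ * (1 - s)) * Real.exp (-(q * (1 - s))) := by gcongr
        _ = _ := by ring
  · exact Continuous.intervalIntegrable (by fun_prop) _ _
  · exact Continuous.intervalIntegrable (by fun_prop) _ _

lemma smoothBound_zero_right (N : ℕ) : smoothBound N 0 = 1 / (N + 1) := by
  simp [smoothBound, integral_pow]

lemma smoothBound_nonneg (N : ℕ) (κ : ℝ) : 0 ≤ smoothBound N κ :=
  intervalIntegral.integral_nonneg zero_le_one fun _ hs =>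
    mul_nonneg (pow_nonneg hs.1 _) (Real.exp_nonneg _)

lemma mul_smoothBound_zero (κ : ℝ) : κ * smoothBound 0 κ = 1 - Real.exp (-κ) := by
  have h : ∀ s ∈ Set.uIcc (0 : ℝ) 1, HasDerivAt (fun s => Real.exp (-κ * (1 - s)))
      (κ * (s ^ 0 * Real.exp (-κ * (1 - s)))) s := by
    intro s _
    have := (((hasDerivAt_id s).const_sub 1).const_mul (-κ)).exp
    convert! this using 1
    simp; ring
  rw [smoothBound, ← intervalIntegral.integral_const_mul,
    intervalIntegral.integral_eq_sub_of_hasDerivAt h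
      (Continuous.intervalIntegrable (by fun_prop) _ _)]
  simp

lemma smoothBound_zero_le_one {κ : ℝ} (hκ : 0 ≤ κ) : smoothBound 0 κ ≤ 1 := by
  rcases hκ.eq_or_lt with rfl | h
  · simp [smoothBound_zero_right]
  · have := mul_smoothBound_zero κ
    have := Real.add_one_le_exp (-κ)
    nlinarith

lemma smoothBound_zero_mul_le {κ : ℝ} (hκ : 0 ≤ κ) :
    smoothBound 0 κ * ((κ / 2 + 1 / 4) * Real.pi / 2) ≤ 1 := by
  have hpi := Real.pi_lt_d2
  have hpi0 := Real.pi_pos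
  have hG := smoothBound_nonneg 0 κ
  -- The constant `81/64` is the maximum of `(1 - κ/4)(κ + 1/2)`, attained at `κ = 7/4`; it stays
  -- below `4/π`.
  suffices h : smoothBound 0 κ * (κ + 1 / 2) ≤ 5 / 4 + 1 / 64 by
    calc _ = (smoothBound 0 κ * (κ + 1 / 2)) * (Real.pi / 4) := by ring
      _ ≤ (5 / 4 + 1 / 64) * (3.15 / 4) := by gcongr
      _ ≤ 1 := by norm_num
  rcases hκ.eq_or_lt with rfl | h
  · norm_num [smoothBound_zero_right]
  have hm := mul_smoothBound_zero κ
  rcases le_total κ 2 with h2 | h2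
  · have h3 := Real.one_sub_div_pow_le_exp_neg (n := 2) (t := κ) (by exact_mod_cast h2)
    have h4 : smoothBound 0 κ ≤ 1 - κ / 4 := by
      push_cast at h3
      nlinarith
    calc _ ≤ (1 - κ / 4) * (κ + 1 / 2) := by gcongr
      _ ≤ _ := by nlinarith [sq_nonneg (κ - 7 / 4)]
  · have := Real.exp_nonneg (-κ)
    nlinarith

/-- Smoothness of Poisson-binomial distributions. -/
lemma abs_act_prod_bern_le {ι : Type*} (s : Finset ι) {p : ι → ℝ} (hp : ∀ i, 0 ≤ p i ∧ p i ≤ 1)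
    (N : ℕ) {φ : ℤ → ℝ} {c : ℝ} (h : ∀ y, |φ y| ≤ c) (x : ℤ) :
    |act ((X - 1) * bern (1 / 2) ^ N * ∏ i ∈ s, bern (p i)) φ x|
      ≤ 2 * c * √(smoothBound N (∑ i ∈ s, 2 * min (p i) (1 - p i))) := by
  classical
  have hc : 0 ≤ c := (abs_nonneg _).trans (h 0)
  -- `N` counts the fair coins already extracted, so it must vary in the induction.
  induction s using Finset.induction_on generalizing N x with
  | empty =>
    rw [Finset.prod_empty, mul_one, Finset.sum_empty, smoothBound_zero_right]
    exact abs_act_half_pow_le N h x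
  | insert i s hi ih =>
    rw [Finset.prod_insert hi, Finset.sum_insert hi, add_comm]
    obtain ⟨h0, h1⟩ := hp i
    set m := min (p i) (1 - p i) with hm
    set κ := ∑ i ∈ s, 2 * min (p i) (1 - p i)
    set R := ∏ i ∈ s, bern (p i)
    have hm0 : 0 ≤ m := le_min h0 (by linarith)
    have hm1 : 2 * m ≤ 1 := by
      have := min_le_left (p i) (1 - p i)
      have := min_le_right (p i) (1 - p i)
      linarith
    set a := √(smoothBound N κ)
    set b := √(smoothBound (N + 1) κ)
    have ha : a ^ 2 = smoothBound N κ := Real.sq_sqrt (smoothBound_nonneg _ _)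
    have hb : b ^ 2 = smoothBound (N + 1) κ := Real.sq_sqrt (smoothBound_nonneg _ _)
    -- Convexity of the square lets the mixture pass under the root.
    have hab : (1 - 2 * m) * a + 2 * m * b ≤ √(smoothBound N (κ + 2 * m)) := by
      apply Real.le_sqrt_of_sq_le
      refine le_trans ?_ (smoothBound_step N κ (2 * m))
      rw [← ha, ← hb]
      have : 0 ≤ (1 - 2 * m) * (2 * m) * (a - b) ^ 2 :=
        mul_nonneg (mul_nonneg (by linarith) (by linarith)) (sq_nonneg _)
      linarith
    have hB := ih (N + 1)
    have hhalf : ∀ y, act ((X - 1) * bern (1 / 2) ^ (N + 1) * R) φ y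
        = (1 - 1 / 2) * act ((X - 1) * bern (1 / 2) ^ N * R) φ y
          + 1 / 2 * act ((X - 1) * bern (1 / 2) ^ N * R) φ (y + 1) := by
      intro y
      rw [← act_bern_mul]; congr 1; ring
    -- With weight `2 * m` the variable is a fair coin, otherwise constant: 0 if `p i ≤ 1/2`, giving
    -- `y = x`, and 1 if `p i ≥ 1/2`, giving `y = x + 1`.
    have hmix : ∃ y, act ((X - 1) * bern (1 / 2) ^ N * (bern (p i) * R)) φ x
        = (1 - 2 * m) * act ((X - 1) * bern (1 / 2) ^ N * R) φ y
          + 2 * m * act ((X - 1) * bern (1 / 2) ^ (N + 1) * R) φ x := by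
      have : (X - 1) * bern (1 / 2) ^ N * (bern (p i) * R)
          = bern (p i) * ((X - 1) * bern (1 / 2) ^ N * R) := by ring
      rw [this, hhalf, act_bern_mul]
      rcases le_total (p i) (1 - p i) with hle | hle
      · exact ⟨x, by rw [hm, min_eq_left hle]; ring⟩
      · exact ⟨x + 1, by rw [hm, min_eq_right hle]; ring⟩
    obtain ⟨y, hy⟩ := hmix
    rw [hy]
    calc _ ≤ (1 - 2 * m) * (2 * c * a) + 2 * m * (2 * c * b) := by
          refine (abs_add_le _ _).trans ?_
          rw [abs_mul, abs_mul, abs_of_nonneg (by linarith : 0 ≤ 1 - 2 * m),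
            abs_of_nonneg (by linarith : 0 ≤ 2 * m)]
          have := ih N y
          have := hB x
          have : 0 ≤ 1 - 2 * m := by linarith
          gcongr
      _ = 2 * c * ((1 - 2 * m) * a + 2 * m * b) := by ring
      _ ≤ _ := by gcongr

lemma sqrt_smoothBound_zero_le {κ w : ℝ} (hκ : 0 ≤ κ) (hw : w ≤ κ / 2 + 1 / 4) :
    √(smoothBound 0 κ) ≤ 1 / max 1 (√(w * Real.pi / 2)) := by
  have hG := smoothBound_nonneg 0 κ
  rw [le_div_iff₀ (by positivity), mul_max_of_nonneg _ _ (Real.sqrt_nonneg _)]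
  refine max_le ?_ ?_
  · rw [mul_one, Real.sqrt_le_iff, one_pow]
    exact ⟨zero_le_one, smoothBound_zero_le_one hκ⟩
  · rw [← Real.sqrt_mul hG, Real.sqrt_le_iff, one_pow]
    refine ⟨zero_le_one, le_trans ?_ (smoothBound_zero_mul_le hκ)⟩
    have := Real.pi_pos
    gcongr

end Smoothing

/-! ### Poisson kernels and the Stein equation -/

section Poisson

variable {lam : ℝ}

lemma pn_singleton (h : 0 < lam) (m : ℕ) :
    pn lam {(m : ℤ)} = Real.exp (-lam) * lam ^ m / m.factorial := by
  have : {y : ℕ | (y : ℤ) ∈ ({(m : ℤ)} : Set ℤ)} = {m} := by ext; simp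
  rw [pn, this, poissonMeasure_real_singleton, Real.coe_toNNReal _ h.le]

lemma pn_singleton_pos (h : 0 < lam) {j : ℤ} (hj : 0 ≤ j) : 0 < pn lam {j} := by
  lift j to ℕ using hj
  rw [pn_singleton h]; positivity

lemma pn_singleton_succ (h : 0 < lam) {j : ℤ} (hj : 0 ≤ j) :
    (j + 1) * pn lam {j + 1} = lam * pn lam {j} := by
  lift j to ℕ using hj
  have : ((j : ℤ) + 1) = ((j + 1 : ℕ) : ℤ) := by push_cast; rfl
  rw [this, pn_singleton h, pn_singleton h, Nat.factorial_succ]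
  push_cast
  field_simp
  ring

lemma pn_union {A B : Set ℤ} (hAB : Disjoint A B) : pn lam (A ∪ B) = pn lam A + pn lam B := by
  have : {y : ℕ | (y : ℤ) ∈ A ∪ B} = {y : ℕ | (y : ℤ) ∈ A} ∪ {y : ℕ | (y : ℤ) ∈ B} := rfl
  rw [pn, this, measureReal_union _ (MeasurableSet.of_discrete)]
  · rfl
  · exact Set.disjoint_left.2 fun y h1 h2 => Set.disjoint_left.1 hAB h1 h2

lemma F_eq_add (lam : ℝ) (j : ℤ) : F lam j = F lam (j - 1) + pn lam {j} := by
  rw [F, F, ← pn_union (by simp)]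
  congr 1
  ext y; simp; omega

lemma Fbar_eq_add (lam : ℝ) (j : ℤ) : Fbar lam j = Fbar lam (j + 1) + pn lam {j} := by
  rw [Fbar, Fbar, ← pn_union (by simp)]
  congr 1
  ext y; simp; omega

lemma F_add_Fbar (lam : ℝ) (j : ℤ) : F lam (j - 1) + Fbar lam j = 1 := by
  rw [F, Fbar, ← pn_union (Set.disjoint_left.2 fun y h1 h2 => by simp at h1 h2; omega)]
  have : {y : ℕ | (y : ℤ) ∈ Set.Iic (j - 1) ∪ Set.Ici j} = Set.univ := by
    ext y; simp; omega
  rw [pn, this, probReal_univ]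

lemma F_neg_one (lam : ℝ) : F lam (-1) = 0 := by
  have : {y : ℕ | (y : ℤ) ∈ Set.Iic (-1)} = ∅ := by ext y; simp; omega
  rw [F, pn, this, measureReal_empty]

lemma F_nonneg (lam : ℝ) (j : ℤ) : 0 ≤ F lam j := measureReal_nonneg

lemma Fbar_nonneg (lam : ℝ) (j : ℤ) : 0 ≤ Fbar lam j := measureReal_nonneg

lemma Fbar_pos (h : 0 < lam) {j : ℤ} (hj : 0 ≤ j) : 0 < Fbar lam j := by
  rw [Fbar_eq_add]
  linarith [pn_singleton_pos h hj, Fbar_nonneg lam (j + 1)]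

lemma F_pos (h : 0 < lam) {j : ℤ} (hj : 0 ≤ j) : 0 < F lam j := by
  rw [F_eq_add]
  linarith [pn_singleton_pos h hj, F_nonneg lam (j - 1)]

/-- The Stein kernel below the level set: `lowerKernel lam j = F (j-1) / (j P(Y = j))` for
`j ≥ 1`, extended to all integers. -/
def lowerKernel (lam : ℝ) (j : ℤ) : ℝ :=
  ∫ t in Set.Ioi (0 : ℝ), Real.exp (-lam * t) * (1 + t) ^ (j - 1)

/-- Half of the exponential decay absorbs the power. This serves both integrability and the
vanishing boundary term at infinity. -/
lemma exp_mul_zpow_le (h : 0 < lam) (m : ℤ) :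
    ∃ K, ∀ t : ℝ, 0 ≤ t → Real.exp (-lam * t) * (1 + t) ^ m ≤ K * Real.exp (-(lam / 2) * t) := by
  set n := m.toNat
  refine ⟨n.factorial * Real.exp (lam / 2) / (lam / 2) ^ n, fun t ht => ?_⟩
  have h1 : (1 + t) ^ m ≤ (1 + t) ^ n := by
    rw [← zpow_natCast]
    exact zpow_le_zpow_right₀ (by linarith) (Int.self_le_toNat m)
  have h2 := Real.pow_div_factorial_le_exp (lam / 2 * (1 + t)) (by positivity) n
  rw [div_le_iff₀ (by positivity), mul_pow] at h2
  have h3 : (1 + t) ^ n ≤ Real.exp (lam / 2 * (1 + t)) * n.factorial / (lam / 2) ^ n := by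
    rw [le_div_iff₀ (by positivity)]; linarith
  calc _ ≤ Real.exp (-lam * t) * (Real.exp (lam / 2 * (1 + t)) * n.factorial / (lam / 2) ^ n) := by
        gcongr; exact h1.trans h3
    _ = n.factorial / (lam / 2) ^ n * (Real.exp (-lam * t) * Real.exp (lam / 2 * (1 + t))) := by
        ring
    _ = n.factorial / (lam / 2) ^ n * (Real.exp (lam / 2) * Real.exp (-(lam / 2) * t)) := by
        rw [← Real.exp_add, ← Real.exp_add]; ring_nf
    _ = _ := by ring

lemma integrableOn_exp_mul_zpow (h : 0 < lam) (m : ℤ) :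
    IntegrableOn (fun t : ℝ => Real.exp (-lam * t) * (1 + t) ^ m) (Set.Ioi 0) := by
  obtain ⟨K, hK⟩ := exp_mul_zpow_le h m
  refine Integrable.mono' ((exp_neg_integrableOn_Ioi 0 (half_pos h)).const_mul K)
    (Measurable.aestronglyMeasurable (by fun_prop)) ?_
  filter_upwards [ae_restrict_mem measurableSet_Ioi] with t ht
  have ht0 : 0 < t := ht
  rw [Real.norm_of_nonneg (by positivity)]
  exact hK t ht0.le

/-- Integration by parts. It is valid for nonpositive `j` too, which allows the Stein equation to be
solved on all integers. -/
lemma lowerKernel_succ (h : 0 < lam) (j : ℤ) :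
    lam * lowerKernel lam (j + 1) = 1 + j * lowerKernel lam j := by
  have hd : ∀ t ∈ Set.Ici (0 : ℝ), HasDerivAt (fun t : ℝ => Real.exp (-lam * t) * (1 + t) ^ j)
      (j * (Real.exp (-lam * t) * (1 + t) ^ (j - 1))
        - lam * (Real.exp (-lam * t) * (1 + t) ^ (j + 1 - 1))) t := by
    intro t ht
    have ht0 : (0 : ℝ) ≤ t := ht
    have h1 := ((hasDerivAt_id t).const_mul (-lam)).exp
    have h2 := (hasDerivAt_zpow j (1 + t) (Or.inl (by positivity))).comp t
      ((hasDerivAt_id t).const_add 1)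
    convert! h1.mul h2 using 1
    simp; ring
  have hi1 := (integrableOn_exp_mul_zpow h (j - 1)).const_mul (j : ℝ)
  have hi2 := (integrableOn_exp_mul_zpow h (j + 1 - 1)).const_mul lam
  have ht : Filter.Tendsto (fun t : ℝ => Real.exp (-lam * t) * (1 + t) ^ j) Filter.atTop
      (nhds 0) := by
    obtain ⟨K, hK⟩ := exp_mul_zpow_le h j
    have hz : Filter.Tendsto (fun t : ℝ => K * Real.exp (-(lam / 2) * t)) Filter.atTop (nhds 0) := by
      rw [← mul_zero K]
      refine Filter.Tendsto.const_mul K (Real.tendsto_exp_atBot.comp ?_)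
      exact Filter.tendsto_id.const_mul_atTop_of_neg (by linarith)
    refine squeeze_zero' ?_ ?_ hz
    · filter_upwards [Filter.eventually_ge_atTop 0] with t ht; positivity
    · filter_upwards [Filter.eventually_ge_atTop 0] with t ht using hK t ht
  have := integral_Ioi_of_hasDerivAt_of_tendsto' hd (hi1.sub hi2) ht
  rw [integral_sub hi1 hi2, integral_const_mul, integral_const_mul] at this
  simp only [mul_zero, Real.exp_zero, add_zero, one_zpow, mul_one] at this
  rw [lowerKernel, lowerKernel]
  linarith

lemma lowerKernel_sub (h : 0 < lam) (j : ℤ) :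
    lowerKernel lam (j + 1) - lowerKernel lam j
      = ∫ t in Set.Ioi (0 : ℝ), t * (Real.exp (-lam * t) * (1 + t) ^ (j - 1)) := by
  rw [lowerKernel, lowerKernel, ← integral_sub (integrableOn_exp_mul_zpow h _)
    (integrableOn_exp_mul_zpow h _)]
  refine setIntegral_congr_fun measurableSet_Ioi fun t ht => ?_
  have ht0 : 0 < t := ht
  have : (1 + t) ^ (j + 1 - 1) = (1 + t) ^ (j - 1) * (1 + t) := by
    rw [← zpow_add_one₀ (by positivity)]; congr 1; ring
  simp only [this]
  ring

lemma lowerKernel_le_succ (h : 0 < lam) (j : ℤ) : lowerKernel lam j ≤ lowerKernel lam (j + 1) := by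
  rw [← sub_nonneg, lowerKernel_sub h]
  refine setIntegral_nonneg measurableSet_Ioi fun t ht => ?_
  have ht0 : 0 < t := ht
  positivity

/-- The increment integrates `t` against a weight growing with `j`, so the largest step below the
level is the last one. -/
lemma lowerKernel_sub_monotone (h : 0 < lam) :
    Monotone fun j => lowerKernel lam (j + 1) - lowerKernel lam j := by
  have hi (j : ℤ) : IntegrableOn (fun t : ℝ => t * (Real.exp (-lam * t) * (1 + t) ^ (j - 1)))
      (Set.Ioi 0) := by
    refine ((integrableOn_exp_mul_zpow h (j + 1 - 1)).sub
      (integrableOn_exp_mul_zpow h (j - 1))).congr_fun (fun t ht => ?_) measurableSet_Ioi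
    have ht0 : 0 < t := ht
    have : (1 + t) ^ (j + 1 - 1) = (1 + t) ^ (j - 1) * (1 + t) := by
      rw [← zpow_add_one₀ (by positivity)]; congr 1; ring
    simp only [Pi.sub_apply, this]
    ring
  intro i j hij
  simp only [lowerKernel_sub h]
  refine setIntegral_mono_on (hi i) (hi j) measurableSet_Ioi fun t ht => ?_
  have ht0 : 0 < t := ht
  have : (1 + t) ^ (i - 1) ≤ (1 + t) ^ (j - 1) := zpow_le_zpow_right₀ (by linarith) (by omega)
  gcongr

lemma lowerKernel_mul (h : 0 < lam) {j : ℤ} (hj : 1 ≤ j) :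
    lowerKernel lam j * (j * pn lam {j}) = F lam (j - 1) := by
  induction j, hj using Int.leInduction with
  | base =>
    have h1 := lowerKernel_succ h 0
    have h2 := pn_singleton_succ h (le_refl 0)
    have h3 := F_eq_add lam 0
    rw [zero_sub, F_neg_one] at h3
    norm_num at h1 h2 h3 ⊢
    rw [h3, h2]
    linear_combination pn lam {0} * h1
  | succ j hj ih =>
    have h1 := lowerKernel_succ h j
    have h2 := pn_singleton_succ h (by omega : 0 ≤ j)
    have h3 := F_eq_add lam j
    push_cast
    rw [add_sub_cancel_right, h3, h2, ← ih]
    linear_combination pn lam {j} * h1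

/-- The Stein kernel above the level set: `upperKernel lam n` is `P(Y ≥ n+1) / ((n+1) P(Y = n+1))`. -/
def upperKernel (lam : ℝ) (n : ℕ) : ℝ := ∫ t in (0 : ℝ)..1, Real.exp (lam * t) * (1 - t) ^ n

lemma upperKernel_succ (lam : ℝ) (n : ℕ) :
    lam * upperKernel lam (n + 1) = (n + 1) * upperKernel lam n - 1 := by
  have h : ∀ t ∈ Set.uIcc (0 : ℝ) 1, HasDerivAt (fun t => Real.exp (lam * t) * (1 - t) ^ (n + 1))
      (lam * (Real.exp (lam * t) * (1 - t) ^ (n + 1))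
        - (n + 1) * (Real.exp (lam * t) * (1 - t) ^ n)) t := by
    intro t _
    have h1 := ((hasDerivAt_id t).const_mul lam).exp
    have h2 := ((hasDerivAt_id t).const_sub 1).pow (n + 1)
    convert! h1.mul h2 using 1
    simp; ring
  have := intervalIntegral.integral_eq_sub_of_hasDerivAt h
      (Continuous.intervalIntegrable (by fun_prop) _ _)
  rw [intervalIntegral.integral_sub (Continuous.intervalIntegrable (by fun_prop) _ _)
    (Continuous.intervalIntegrable (by fun_prop) _ _), intervalIntegral.integral_const_mul,
    intervalIntegral.integral_const_mul] at this
  simp at this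
  rw [upperKernel, upperKernel]
  linarith

lemma upperKernel_sub (lam : ℝ) (n : ℕ) : upperKernel lam n - upperKernel lam (n + 1)
    = ∫ t in (0 : ℝ)..1, t * (Real.exp (lam * t) * (1 - t) ^ n) := by
  rw [upperKernel, upperKernel, ← intervalIntegral.integral_sub
    (Continuous.intervalIntegrable (by fun_prop) _ _)
    (Continuous.intervalIntegrable (by fun_prop) _ _)]
  congr 1
  ext t
  ring

lemma upperKernel_succ_le (lam : ℝ) (n : ℕ) : upperKernel lam (n + 1) ≤ upperKernel lam n := by
  rw [← sub_nonneg, upperKernel_sub]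
  refine intervalIntegral.integral_nonneg zero_le_one fun t ht => ?_
  have : 0 ≤ 1 - t := by linarith [ht.2]
  have := ht.1
  positivity

/-- Powers of `1 - t` decrease with the exponent, so the largest step above the level is the first
one. -/
lemma upperKernel_sub_antitone (lam : ℝ) :
    Antitone fun n => upperKernel lam n - upperKernel lam (n + 1) := by
  intro m n hmn
  simp only [upperKernel_sub]
  refine intervalIntegral.integral_mono_on zero_le_one
    (Continuous.intervalIntegrable (by fun_prop) _ _)
    (Continuous.intervalIntegrable (by fun_prop) _ _) fun t ht => ?_
  have h1 : (1 - t) ^ n ≤ (1 - t) ^ m :=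
    pow_le_pow_of_le_one (by linarith [ht.2]) (by linarith [ht.1]) hmn
  have := ht.1
  gcongr

lemma upperKernel_mul (h : 0 < lam) (n : ℕ) :
    upperKernel lam n * ((n + 1) * pn lam {(n : ℤ) + 1}) = Fbar lam (n + 1) := by
  induction n with
  | zero =>
    have h1 : lam * upperKernel lam 0 = Real.exp lam - 1 := by
      have hd : ∀ t ∈ Set.uIcc (0 : ℝ) 1, HasDerivAt (fun t => Real.exp (lam * t))
          (lam * (Real.exp (lam * t) * (1 - t) ^ 0)) t := by
        intro t _
        convert! ((hasDerivAt_id t).const_mul lam).exp using 1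
        simp; ring
      rw [upperKernel, ← intervalIntegral.integral_const_mul,
        intervalIntegral.integral_eq_sub_of_hasDerivAt hd
          (Continuous.intervalIntegrable (by fun_prop) _ _)]
      simp
    have h2 := pn_singleton_succ h (le_refl 0)
    have h3 := Fbar_eq_add lam 0
    have h4 := F_add_Fbar lam 0
    have h5 := pn_singleton h 0
    have h6 : Real.exp (-lam) * Real.exp lam = 1 := by rw [← Real.exp_add]; simp
    rw [zero_sub, F_neg_one] at h4
    norm_num at h2 h3 h4 h5 ⊢
    rw [h2]
    linear_combination pn lam {0} * h1 + (Real.exp lam) * h5 + h6 + h3 - h4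
  | succ n ih =>
    have h1 := upperKernel_succ lam n
    have h2 := pn_singleton_succ h (by omega : 0 ≤ (n : ℤ) + 1)
    have h3 := Fbar_eq_add lam (n + 1)
    push_cast at h2 ⊢
    rw [h2]
    linear_combination pn lam {(n : ℤ) + 1} * h1 + ih + h3

lemma C0_mul_one_sub_upperTerm (h : 0 < lam) (n : ℕ) :
    Fbar lam (n + 1) * (C0 lam (n + 1) * (1 - upperTerm lam (n + 1)))
      = F lam n * (upperKernel lam n - upperKernel lam (n + 1)) := by
  have h1 := upperKernel_mul h n
  have h2 := upperKernel_mul h (n + 1)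
  have h3 := pn_singleton_succ h (by omega : 0 ≤ (n : ℤ) + 1)
  have hp := pn_singleton_pos h (by omega : 0 ≤ (n : ℤ) + 1)
  have hF := Fbar_pos h (by omega : 0 ≤ (n : ℤ) + 1)
  push_cast at h2 h3
  rw [h3] at h2
  have hn : (0 : ℝ) < (n : ℝ) + 1 := by positivity
  rw [C0, upperTerm, ← h2, add_sub_cancel_right]
  push_cast
  have e1 : Fbar lam (n + 1) * (1 - upperKernel lam (n + 1) * (lam * pn lam {(n : ℤ) + 1})
      / Fbar lam (n + 1) * (((n : ℝ) + 1) / lam))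
      = Fbar lam (n + 1) - upperKernel lam (n + 1) * (pn lam {(n : ℤ) + 1}) * (n + 1) := by
    field_simp
  rw [mul_left_comm, e1, ← h1]
  field_simp

lemma C0_eq_lowerKernel (h : 0 < lam) {k : ℤ} (hk : 1 ≤ k) : C0 lam k = lowerKernel lam k := by
  have hp := pn_singleton_pos h (by omega : 0 ≤ k)
  have hk0 : (0 : ℝ) < k := by exact_mod_cast hk
  rw [C0, ← lowerKernel_mul h hk]
  field_simp

lemma C0_mul_one_sub_lowerTerm (h : 0 < lam) {k : ℤ} (hk : 2 ≤ k) :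
    C0 lam k * (1 - lowerTerm lam k) = lowerKernel lam k - lowerKernel lam (k - 1) := by
  have h1 := lowerKernel_mul h (by omega : 1 ≤ k)
  have h2 := lowerKernel_mul h (by omega : 1 ≤ k - 1)
  have h3 := pn_singleton_succ h (by omega : 0 ≤ k - 1)
  have hp := pn_singleton_pos h (by omega : 0 ≤ k - 1)
  have hF := F_pos h (by omega : 0 ≤ k - 1)
  have hk2 : (2 : ℝ) ≤ k := by exact_mod_cast hk
  have hk0 : (0 : ℝ) < k - 1 := by linarith
  rw [sub_add_cancel] at h3
  push_cast at h2 h3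
  rw [sub_add_cancel] at h3
  rw [h3] at h1
  have e : k - 1 - 1 = k - 2 := by ring
  rw [e] at h2
  have hg : lowerKernel lam k ≠ 0 := by
    intro h0; rw [h0, zero_mul] at h1; exact hF.ne h1
  rw [C0_eq_lowerKernel h (by omega), lowerTerm, if_neg (by omega), ← h1, ← h2]
  field_simp

/-- A solution of the Stein equation for the indicator of `[k, ∞)`, with bounds on its
increments. -/
theorem exists_stein_solution (h : 0 < lam) {k : ℤ} (hk : 1 ≤ k) : ∃ f : ℤ → ℝ,
    (∀ j : ℤ, 2 ≤ k ∨ 0 ≤ j →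
      lam * f (j + 1) - j * f j = (if k ≤ j then 1 else 0) - Fbar lam k) ∧
    ∀ j, -(Fbar lam k * (C0 lam k * (1 - lowerTerm lam k))) ≤ f (j + 1) - f j ∧
      f (j + 1) - f j ≤ Fbar lam k * (C0 lam k * (1 - upperTerm lam k)) := by
  obtain ⟨n, rfl⟩ : ∃ n : ℕ, k = n + 1 := ⟨(k - 1).toNat, by omega⟩
  set k : ℤ := n + 1 with hkn
  -- For `k = 1` the lower branch is frozen, matching the convention `lowerTerm lam 1 = 1`; below
  -- the level the equation is then claimed only at `j = 0`.
  set g : ℤ → ℝ := fun j => if k = 1 then lowerKernel lam 1 else lowerKernel lam j with hg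
  have hFk : F lam (k - 1) + Fbar lam k = 1 := F_add_Fbar lam k
  have hFn : F lam (k - 1) = F lam n := by rw [hkn, add_sub_cancel_right]
  have hF0 := Fbar_nonneg lam k
  -- The two branches of `f` agree at `k`.
  have hgk : Fbar lam k * g k = F lam (k - 1) * upperKernel lam n := by
    have h1 : g k = lowerKernel lam k := by
      simp only [hg]; split_ifs with h1
      · rw [h1]
      · rfl
    have h2 := lowerKernel_mul h hk
    have h3 := upperKernel_mul h n
    rw [h1, ← h2, hkn, ← h3]
    push_cast
    ring
  set f : ℤ → ℝ := fun j => if j ≤ k then -(Fbar lam k * g j)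
    else -(F lam (k - 1) * upperKernel lam (j - 1).toNat) with hf
  have hlow : ∀ j, j ≤ k → f j = -(Fbar lam k * g j) := fun j hj => if_pos hj
  have hup : ∀ m : ℕ, f (k + m) = -(F lam (k - 1) * upperKernel lam (n + m)) := by
    intro m
    rcases Nat.eq_zero_or_pos m with rfl | hm
    · rw [hlow _ (by simp), ← neg_inj]; simpa using hgk
    · simp only [hf]
      rw [if_neg (by omega)]
      congr 3
      omega
  have hC : Fbar lam k * (C0 lam k * (1 - upperTerm lam k))
      = F lam (k - 1) * (upperKernel lam n - upperKernel lam (n + 1)) := by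
    rw [hFn]; exact C0_mul_one_sub_upperTerm h n
  have hC0 : 0 ≤ Fbar lam k * (C0 lam k * (1 - upperTerm lam k)) := by
    rw [hC]
    exact mul_nonneg (F_nonneg _ _) (sub_nonneg.2 (upperKernel_succ_le _ _))
  have hL0 : 0 ≤ Fbar lam k * (C0 lam k * (1 - lowerTerm lam k)) := by
    refine mul_nonneg hF0 ?_
    rcases hk.eq_or_lt with h1 | h1
    · rw [lowerTerm, if_pos h1.symm]; simp
    · rw [C0_mul_one_sub_lowerTerm h h1, sub_nonneg]
      simpa using lowerKernel_le_succ h (k - 1)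
  refine ⟨f, fun j hj => ?_, fun j => ?_⟩
  · rcases lt_or_ge j k with hjk | hjk
    · rw [if_neg (by omega), hlow _ (by omega), hlow _ hjk.le]
      rcases hk.eq_or_lt with h1 | h1
      · have hj0 : j = 0 := by omega
        have := lowerKernel_succ h 0
        simp only [hg, if_pos h1.symm, hj0]
        push_cast at this
        norm_num at this ⊢
        linear_combination Fbar lam k * this
      · have := lowerKernel_succ h j
        simp only [hg, if_neg h1.ne']
        linear_combination -(Fbar lam k) * this
    · obtain ⟨m, rfl⟩ : ∃ m : ℕ, j = k + m := ⟨(j - k).toNat, by omega⟩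
      have h1 := hup (m + 1)
      rw [Nat.cast_succ, ← add_assoc] at h1
      rw [if_pos hjk, h1, hup, ← add_assoc]
      have := upperKernel_succ lam (n + m)
      rw [hkn]
      push_cast at this ⊢
      rw [← hkn]
      linear_combination -(F lam (k - 1)) * this + hFk
  · rcases lt_or_ge j k with hjk | hjk
    · rw [hlow _ (by omega : j + 1 ≤ k), hlow _ hjk.le]
      rcases hk.eq_or_lt with h1 | h1
      · simp only [hg, if_pos h1.symm, sub_self]
        exact ⟨by linarith, hC0⟩
      · simp only [hg, if_neg h1.ne']
        have h2 := lowerKernel_le_succ h j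
        have h3 := lowerKernel_sub_monotone h (by omega : j ≤ k - 1)
        simp only [sub_add_cancel] at h3
        rw [← C0_mul_one_sub_lowerTerm h h1] at h3
        have h4 := mul_le_mul_of_nonneg_left h3 hF0
        have h5 := mul_nonneg hF0 (sub_nonneg.2 h2)
        constructor <;> linarith
    · obtain ⟨m, rfl⟩ : ∃ m : ℕ, j = k + m := ⟨(j - k).toNat, by omega⟩
      have h1 := hup (m + 1)
      rw [Nat.cast_succ, ← add_assoc] at h1
      rw [h1, hup, ← add_assoc]
      have h2 := upperKernel_succ_le lam (n + m)
      have h3 := upperKernel_sub_antitone lam (by omega : n ≤ n + m)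
      have h4 := mul_le_mul_of_nonneg_left h3 (F_nonneg lam (k - 1))
      have h5 := mul_nonneg (F_nonneg lam (k - 1)) (sub_nonneg.2 h2)
      simp only [← hC] at h4
      constructor <;> linarith

end Poisson

/-! ### Laws and moments of Bernoulli sums -/

section Law

variable {Ω : Type*} [MeasurableSpace Ω] {P : Measure Ω}
  {ι : Type*} {p : ι → ℝ} {X : ι → Ω → ℕ}

lemma integral_bernoulli {Y : Ω → ℕ} (hYm : Measurable Y) (hY : ∀ᵐ ω ∂P, Y ω = 0 ∨ Y ω = 1) :
    ∫ ω, (Y ω : ℝ) ∂P = P.real {ω | Y ω = 1} := by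
  have hm : MeasurableSet {ω | Y ω = 1} := hYm (measurableSet_singleton 1)
  rw [← integral_indicator_one hm]
  refine integral_congr_ae ?_
  filter_upwards [hY] with ω h
  rcases h with h | h <;> simp [h]

lemma ae_sum_le (hX01 : ∀ i, ∀ᵐ ω ∂P, X i ω = 0 ∨ X i ω = 1) (s : Finset ι) :
    ∀ᵐ ω ∂P, ∑ i ∈ s, X i ω ≤ s.card := by
  have : ∀ᵐ ω ∂P, ∀ i ∈ s, X i ω = 0 ∨ X i ω = 1 := (ae_ball_iff s.countable_toSet).2 fun i _ => hX01 i
  filter_upwards [this] with ω h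
  calc ∑ i ∈ s, X i ω ≤ ∑ i ∈ s, 1 := Finset.sum_le_sum fun i hi => by rcases h i hi with h | h <;> omega
    _ = _ := by simp

variable [IsProbabilityMeasure P]

lemma integrable_comp_of_le {Y : Ω → ℕ} (hYm : Measurable Y) (N : ℕ) (hY : ∀ᵐ ω ∂P, Y ω ≤ N)
    (φ : ℕ → ℝ) : Integrable (fun ω => φ (Y ω)) P := by
  refine Integrable.of_bound (C := ∑ m ∈ Finset.range (N + 1), |φ m|)
    ((measurable_of_countable φ).comp hYm).aestronglyMeasurable ?_
  filter_upwards [hY] with ω h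
  exact Finset.single_le_sum (f := fun m => |φ m|) (fun m _ => abs_nonneg _)
    (Finset.mem_range.2 (Nat.lt_succ_of_le h))

/-- Conditioning on one summand, by independence, is multiplication by its factor `bern (p i)`. -/
lemma integral_comp_sum (hXm : ∀ i, Measurable (X i))
    (hX01 : ∀ i, ∀ᵐ ω ∂P, X i ω = 0 ∨ X i ω = 1) (hXp : ∀ i, P.real {ω | X i ω = 1} = p i)
    (hXindep : iIndepFun X P) (s : Finset ι) (φ : ℤ → ℝ) (x : ℤ) :
    ∫ ω, φ (x + (∑ i ∈ s, X i ω : ℕ)) ∂P = act (∏ i ∈ s, bern (p i)) φ x := by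
  classical
  induction s using Finset.induction_on generalizing x with
  | empty => simp [act_one]
  | insert i s hi ih =>
    set S : Ω → ℕ := fun ω => ∑ j ∈ s, X j ω with hS
    have hSm : Measurable S := Finset.measurable_fun_sum s fun j _ => hXm j
    have hSb : ∀ᵐ ω ∂P, S ω ≤ s.card := ae_sum_le hX01 s
    have hind : IndepFun (X i) S P := by
      have := (hXindep.indepFun_finsetSum_of_notMem hXm hi).symm
      have e : (∑ j ∈ s, X j) = S := by ext ω; simp [hS]
      rwa [e] at this
    set ψ : ℕ → ℝ := fun m => φ (x + 1 + m) - φ (x + m) with hψ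
    have hi1 : Integrable (fun ω => φ (x + S ω)) P :=
      integrable_comp_of_le hSm _ hSb fun m => φ (x + m)
    have hi1' : Integrable (fun ω => φ (x + 1 + S ω)) P :=
      integrable_comp_of_le hSm _ hSb fun m => φ (x + 1 + m)
    have hiψ : Integrable (fun ω => ψ (S ω)) P := integrable_comp_of_le hSm _ hSb ψ
    have hiX : Integrable (fun ω => (X i ω : ℝ)) P :=
      integrable_comp_of_le (hXm i) 1 (by filter_upwards [hX01 i] with ω h; omega) fun m => (m : ℝ)
    have hind' : IndepFun (fun ω => (X i ω : ℝ)) (fun ω => ψ (S ω)) P :=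
      hind.comp (measurable_of_countable (fun m : ℕ => (m : ℝ))) (measurable_of_countable ψ)
    have hi2 : Integrable (fun ω => (X i ω : ℝ) * ψ (S ω)) P := hind'.integrable_mul hiX hiψ
    have hsplit : ∫ ω, φ (x + (∑ j ∈ insert i s, X j ω : ℕ)) ∂P
        = ∫ ω, (φ (x + S ω) + (X i ω : ℝ) * ψ (S ω)) ∂P := by
      refine integral_congr_ae ?_
      filter_upwards [hX01 i] with ω h
      simp only [Finset.sum_insert hi]
      rcases h with h | h
      · simp [h, hS]
      · simp only [h, hψ, hS]
        push_cast
        rw [← add_assoc]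
        ring
    have hmul : ∫ ω, (X i ω : ℝ) * ψ (S ω) ∂P = (∫ ω, (X i ω : ℝ) ∂P) * ∫ ω, ψ (S ω) ∂P :=
      hind'.integral_fun_mul_eq_mul_integral hiX.aestronglyMeasurable hiψ.aestronglyMeasurable
    have hψI : ∫ ω, ψ (S ω) ∂P = ∫ ω, φ (x + 1 + S ω) ∂P - ∫ ω, φ (x + S ω) ∂P :=
      integral_sub hi1' hi1
    rw [hsplit, integral_add hi1 hi2, hmul, hψI, ih, ih, integral_bernoulli (hXm i) (hX01 i),
      hXp, Finset.prod_insert hi, act_bern_mul]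
    ring

lemma variance_bernoulli {Y : Ω → ℕ} (hYm : Measurable Y) (hY : ∀ᵐ ω ∂P, Y ω = 0 ∨ Y ω = 1) :
    Var[fun ω => (Y ω : ℝ); P] = P.real {ω | Y ω = 1} * (1 - P.real {ω | Y ω = 1}) := by
  have hL : MemLp (fun ω => (Y ω : ℝ)) 2 P :=
    MemLp.of_bound ((measurable_of_countable (fun m : ℕ => (m : ℝ))).comp hYm).aestronglyMeasurable 1
      (by filter_upwards [hY] with ω h; rcases h with h | h <;> simp [h])
  rw [variance_eq_sub hL, ← integral_bernoulli hYm hY]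
  have : ∫ ω, ((fun ω => (Y ω : ℝ)) ^ 2) ω ∂P = ∫ ω, (Y ω : ℝ) ∂P := by
    refine integral_congr_ae ?_
    filter_upwards [hY] with ω h
    rcases h with h | h <;> simp [h]
  rw [this]
  ring

lemma variance_sum_bernoulli (hXm : ∀ i, Measurable (X i))
    (hX01 : ∀ i, ∀ᵐ ω ∂P, X i ω = 0 ∨ X i ω = 1) (hXp : ∀ i, P.real {ω | X i ω = 1} = p i)
    (hXindep : iIndepFun X P) (s : Finset ι) :
    Var[fun ω => ((∑ i ∈ s, X i ω : ℕ) : ℝ); P] = ∑ i ∈ s, p i * (1 - p i) := by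
  have hm : Measurable fun m : ℕ => (m : ℝ) := measurable_of_countable _
  have e : (fun ω => ((∑ i ∈ s, X i ω : ℕ) : ℝ)) = ∑ i ∈ s, fun ω => (X i ω : ℝ) := by
    ext ω; simp
  rw [e, IndepFun.variance_sum]
  · refine Finset.sum_congr rfl fun i _ => ?_
    rw [variance_bernoulli (hXm i) (hX01 i), hXp]
  · intro i _
    exact MemLp.of_bound (hm.comp (hXm i)).aestronglyMeasurable 1
      (by filter_upwards [hX01 i] with ω h; rcases h with h | h <;> simp [h])
  · intro i _ j _ hij
    exact (hXindep.indepFun hij).comp hm hm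

end Law

/-! ### Expansion and bounds for the Stein operator -/

section SteinBound

open Polynomial

variable {ι : Type*} [Fintype ι] [DecidableEq ι]

lemma prod_bern_eq (p : ι → ℝ) (i : ι) :
    ∏ j, bern (p j) = bern (p i) * ∏ j ∈ Finset.univ.erase i, bern (p j) :=
  (Finset.mul_prod_erase _ _ (Finset.mem_univ i)).symm

/-- In the `i`-th term of the product rule, `bern (p i) - 1 = p i (X - 1)` supplies the second
factor `p i`. -/
lemma stein_polynomial_one (p : ι → ℝ) :
    C (∑ i, p i) * (X * ∏ i, bern (p i)) - X * derivative (∏ i, bern (p i))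
      = ∑ i, C (p i ^ 2) * (X * ((∏ j ∈ Finset.univ.erase i, bern (p j)) * (X - 1))) := by
  rw [derivative_prod_finset, map_sum, Finset.sum_mul, Finset.mul_sum, ← Finset.sum_sub_distrib]
  refine Finset.sum_congr rfl fun i _ => ?_
  have : derivative (bern (p i)) = C (p i) := by simp [bern]
  rw [this, prod_bern_eq p i]
  conv_lhs => rw [bern]
  simp only [map_pow, map_sub, map_one]
  ring

/-- The outer `X` in each term is split as `bern (p i) + (1 - p i)(X - 1)`: the first part restores
the full product, the second gives a second difference. -/
lemma stein_polynomial_two (p : ι → ℝ) (a : ℝ) :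
    C (∑ i, p i - a) * (X * ∏ i, bern (p i)) - X * derivative (∏ i, bern (p i))
        + C a * ∏ i, bern (p i)
      = ∑ i, C (p i ^ 2 * (1 - p i)) *
          (((X - 1) * bern (1 / 2) ^ 0 * ∏ j ∈ Finset.univ.erase i, bern (p j)) * (X - 1))
        + C (∑ i, p i ^ 2 - a) * ((∏ i, bern (p i)) * (X - 1)) := by
  have h := stein_polynomial_one p
  have h2 : ∑ i, C (p i ^ 2) * (X * ((∏ j ∈ Finset.univ.erase i, bern (p j)) * (X - 1)))
      = ∑ i, C (p i ^ 2 * (1 - p i)) *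
          (((X - 1) * bern (1 / 2) ^ 0 * ∏ j ∈ Finset.univ.erase i, bern (p j)) * (X - 1))
        + C (∑ i, p i ^ 2) * ((∏ i, bern (p i)) * (X - 1)) := by
    rw [map_sum C (fun i => p i ^ 2), Finset.sum_mul, ← Finset.sum_add_distrib]
    refine Finset.sum_congr rfl fun i _ => ?_
    rw [prod_bern_eq p i]
    generalize ∏ j ∈ Finset.univ.erase i, bern (p j) = Q
    simp only [bern, map_mul, map_pow, map_sub, map_one, pow_zero]
    ring
  rw [C_sub, C_sub]
  linear_combination h + h2

variable {p : ι → ℝ} (hp : ∀ i, 0 ≤ p i ∧ p i ≤ 1) {ψ : ℤ → ℝ} {L U : ℝ}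
  (hψ : ∀ y, -L ≤ ψ (y + 1) - ψ y ∧ ψ (y + 1) - ψ y ≤ U)
include hp hψ

lemma abs_stein_one_le :
    |act (C (∑ i, p i) * (X * ∏ i, bern (p i)) - X * derivative (∏ i, bern (p i))) ψ 0|
      ≤ max L U * ∑ i, p i ^ 2 := by
  rw [stein_polynomial_one, act_sum, Finset.mul_sum]
  refine (Finset.abs_sum_le_sum_abs _ _).trans (Finset.sum_le_sum fun i _ => ?_)
  rw [act_C_mul, act_X_mul, act_mul_X_sub_one, abs_mul, abs_of_nonneg (sq_nonneg _), mul_comm]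
  gcongr
  refine (isAvg_prod _ hp).abs_le (fun y => abs_le.2 ⟨?_, (hψ y).2.trans (le_max_right _ _)⟩) _
  linarith [(hψ y).1, le_max_left L U]

lemma abs_stein_two_le (a : ℝ) :
    |act (C (∑ i, p i - a) * (X * ∏ i, bern (p i)) - X * derivative (∏ i, bern (p i))
        + C a * ∏ i, bern (p i)) ψ 0|
      ≤ (L + U) * (∑ i, p i ^ 2 * (1 - p i))
          / max 1 (√((∑ i, min (p i) (1 - p i) - 1 / 4) * Real.pi / 2))
        + max L U * |∑ i, p i ^ 2 - a| := by
  have hLU : 0 ≤ L + U := by linarith [(hψ 0).1, (hψ 0).2]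
  rw [stein_polynomial_two, act_add, act_sum]
  refine (abs_add_le _ _).trans (add_le_add ?_ ?_)
  · rw [Finset.mul_sum, Finset.sum_div]
    refine (Finset.abs_sum_le_sum_abs _ _).trans (Finset.sum_le_sum fun i _ => ?_)
    have h0 : 0 ≤ p i ^ 2 * (1 - p i) := mul_nonneg (sq_nonneg _) (by linarith [(hp i).2])
    rw [act_C_mul, act_mul_X_sub_one, abs_mul, abs_of_nonneg h0, mul_comm (L + U), mul_div_assoc]
    gcongr
    set T : ℝ[X] := (X - 1) * bern (1 / 2) ^ 0 * ∏ j ∈ Finset.univ.erase i, bern (p j) with hT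
    -- The midpoint of `[-L, U]`. `T` annihilates constants, so centring reduces the sup bound to
    -- `(L + U) / 2`, and the 2 in the smoothness estimate cancels.
    set d := (U - L) / 2
    have hconst : act T (fun _ => d) 0 = 0 := by
      have e : T = (∏ j ∈ Finset.univ.erase i, bern (p j)) * (X - 1) := by rw [hT]; ring
      rw [e, act_mul_X_sub_one, sub_self, (isAvg_prod _ hp).1]
    have hshift : act T (fun y => ψ (y + 1) - ψ y) 0
        = act T (fun y => ψ (y + 1) - ψ y - d) 0 := by
      rw [act_sub_right T (fun y => ψ (y + 1) - ψ y), hconst, sub_zero]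
    rw [hshift]
    refine (abs_act_prod_bern_le _ hp 0 (c := (L + U) / 2) (fun y => abs_le.2 ?_) 0).trans ?_
    · constructor <;> simp only [d] <;> linarith [(hψ y).1, (hψ y).2]
    · rw [mul_div_cancel₀ _ two_ne_zero, div_eq_mul_one_div]
      have hm (j : ι) : 0 ≤ min (p j) (1 - p j) := le_min (hp j).1 (by linarith [(hp j).2])
      refine mul_le_mul_of_nonneg_left (sqrt_smoothBound_zero_le
        (Finset.sum_nonneg fun j _ => by linarith [hm j]) ?_) hLU
      -- Dropping the `i`-th coin costs at most `1/2`, which turns the `+ 1/4` into `- 1/4`.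
      rw [← Finset.mul_sum, ← Finset.add_sum_erase _ _ (Finset.mem_univ i)]
      linarith [min_le_left (p i) (1 - p i), min_le_right (p i) (1 - p i)]
  · rw [act_C_mul, act_mul_X_sub_one, abs_mul, mul_comm]
    gcongr
    refine (isAvg_prod _ hp).abs_le (fun y => abs_le.2 ⟨?_, (hψ y).2.trans (le_max_right _ _)⟩) _
    linarith [(hψ y).1, le_max_left L U]

end SteinBound

/-! ### Tail identity and conclusion -/

lemma Fbar_mul_C1 {lam : ℝ} (h : 0 < lam) {k : ℤ} (hk : 1 ≤ k) :
    max (Fbar lam k * (C0 lam k * (1 - lowerTerm lam k)))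
      (Fbar lam k * (C0 lam k * (1 - upperTerm lam k))) = Fbar lam k * C1 lam k := by
  have hC0 : 0 ≤ C0 lam k := by
    have := pn_singleton_pos h (by omega : 0 ≤ k)
    have hk0 : (0 : ℝ) < k := by exact_mod_cast hk
    exact div_nonneg (F_nonneg _ _) (by positivity)
  rw [← mul_max_of_nonneg _ _ (Fbar_nonneg lam k), ← mul_max_of_nonneg _ _ hC0, C1,
    ← max_sub_sub_left]

lemma abs_div_sub_one_le {x y B : ℝ} (hy : 0 < y) (h : |x - y| ≤ y * B) : |x / y - 1| ≤ B := by
  rw [div_sub_one hy.ne', abs_div, abs_of_pos hy, div_le_iff₀ hy, mul_comm B]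
  exact h

open Polynomial in
/-- The Stein identity for the tail probabilities of a shifted Poisson-binomial variable. -/
lemma tail_sub_eq {Ω : Type*} [MeasurableSpace Ω] {P : Measure Ω} [IsProbabilityMeasure P]
    {ι : Type*} [Fintype ι] {p : ι → ℝ} {Y : ι → Ω → ℕ} (hYm : ∀ i, Measurable (Y i))
    (hY01 : ∀ i, ∀ᵐ ω ∂P, Y i ω = 0 ∨ Y i ω = 1) (hYp : ∀ i, P.real {ω | Y i ω = 1} = p i)
    (hYindep : iIndepFun Y P) {lam : ℝ} {a k : ℤ} (hka : 2 ≤ k ∨ a = 0) {f : ℤ → ℝ}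
    (hf : ∀ j : ℤ, 2 ≤ k ∨ 0 ≤ j →
      lam * f (j + 1) - j * f j = (if k ≤ j then 1 else 0) - Fbar lam k) :
    P.real {ω | k ≤ ((∑ i, Y i ω : ℕ) : ℤ) - a} - Fbar lam k
      = act (C lam * (X * ∏ i, bern (p i)) - X * derivative (∏ i, bern (p i))
          + C (a : ℝ) * ∏ i, bern (p i)) (fun y => f (y - a)) 0 := by
  set W : Ω → ℕ := fun ω => ∑ i, Y i ω with hW
  have hWm : Measurable W := Finset.measurable_fun_sum _ fun j _ => hYm j
  have hm : MeasurableSet {ω | k ≤ (W ω : ℤ) - a} :=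
    hWm (MeasurableSet.of_discrete (s := {m : ℕ | k ≤ (m : ℤ) - a}))
  -- The weight `y` of the Stein operator at `y - a` is `y - a`; the leftover `a * f (y - a)` is
  -- kept separate so that the Euler identity applies at base point 0.
  have hlaw := integral_comp_sum hYm hY01 hYp hYindep Finset.univ
    (fun y => (lam * f (y + 1 - a) - ((y : ℝ) - (0 : ℤ)) * f (y - a)) + a * f (y - a)) 0
  rw [act_add_right, act_sub_right, act_mul_right, act_mul_right, act_id_mul] at hlaw
  have hX : act (X * ∏ i, bern (p i)) (fun y => f (y - a)) 0
      = act (∏ i, bern (p i)) (fun y => f (y + 1 - a)) 0 := by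
    rw [mul_comm, act_mul]
    congr 1
    ext y
    rw [act_X]
  rw [act_add, act_sub, act_C_mul, act_C_mul, hX, ← hlaw, ← integral_indicator_one hm]
  have hI : Integrable ({ω | k ≤ (W ω : ℤ) - a}.indicator (1 : Ω → ℝ)) P :=
    (integrable_const (1 : ℝ)).indicator hm
  have hc : ∫ _ : Ω, Fbar lam k ∂P = Fbar lam k := by simp
  rw [← hc, ← integral_sub hI (integrable_const _)]
  refine integral_congr_ae (Filter.Eventually.of_forall fun ω => ?_)
  have := hf (W ω - a) (by rcases hka with h | h <;> omega)
  simp only [Set.indicator_apply, Set.mem_ofPred_eq, Pi.one_apply]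
  rw [← this, zero_add]
  have e : (W ω : ℤ) - a + 1 = (W ω : ℤ) + 1 - a := by ring
  have hWω : ∑ i, Y i ω = W ω := rfl
  rw [e, hWω]
  push_cast
  ring

end PoissonBinomial

end

theorem mainTheorem6 {Ω : Type*} [MeasurableSpace Ω] (P : Measure Ω) [IsProbabilityMeasure P]
    {n : ℕ} (hn : 1 ≤ n) (p : Fin n → ℝ) (hp : ∀ i, 0 < p i ∧ p i < 1)
    (X : Fin n → Ω → ℕ) (hXm : ∀ i, Measurable (X i))
    (hX01 : ∀ i, ∀ᵐ ω ∂P, X i ω = 0 ∨ X i ω = 1)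
    (hXp : ∀ i, P.real {ω | X i ω = 1} = p i)
    (hXindep : iIndepFun X P)
    (W : Ω → ℕ) (hW : W = fun ω => ∑ i, X i ω)
    (μ σsq μ₂ : ℝ) (hμ : μ = ∫ ω, (W ω : ℝ) ∂P)
    (hσsq : σsq = ProbabilityTheory.variance (fun ω => (W ω : ℝ)) P)
    (hμ₂ : μ₂ = ∑ i, p i ^ 2)
    (a : ℤ) (ha : a = ⌊μ₂⌋) (lam : ℝ) (hlam : lam = μ - a)
    (k : ℤ) (hk : μ < k) :
    |P.real {ω | k ≤ (W ω : ℤ)} / PoissonBinomial.pn μ (Set.Ici k) - 1|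
        ≤ PoissonBinomial.C1 μ k * μ₂ ∧
    |P.real {ω | k ≤ (W ω : ℤ) - a} / PoissonBinomial.pn lam (Set.Ici k) - 1|
        ≤ PoissonBinomial.C2 lam k * (∑ i, p i ^ 2 * (1 - p i))
            / max 1 (Real.sqrt (((∑ i, min (p i) (1 - p i)) - 1 / 4) * Real.pi / 2))
          + PoissonBinomial.C1 lam k * |lam - σsq|
          + Real.exp (-(lam + 2) ^ 2 / (2 * μ)) := by
  have hp' : ∀ i, 0 ≤ p i ∧ p i ≤ 1 := fun i => ⟨(hp i).1.le, (hp i).2.le⟩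
  have hne : (Finset.univ : Finset (Fin n)).Nonempty := ⟨⟨0, hn⟩, Finset.mem_univ _⟩
  have hμsum : μ = ∑ i, p i := by
    rw [hμ, hW]
    push_cast
    rw [integral_finsetSum]
    · exact Finset.sum_congr rfl fun i _ => by
        rw [PoissonBinomial.integral_bernoulli (hXm i) (hX01 i), hXp]
    · intro i _
      exact PoissonBinomial.integrable_comp_of_le (hXm i) 1
        (by filter_upwards [hX01 i] with ω h; omega) fun m => (m : ℝ)
  have hσ : σsq = μ - μ₂ := by
    rw [hσsq, hW, PoissonBinomial.variance_sum_bernoulli hXm hX01 hXp hXindep, hμsum, hμ₂,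
      ← Finset.sum_sub_distrib]
    exact Finset.sum_congr rfl fun i _ => by ring
  have hσpos : 0 < μ - μ₂ := by
    rw [hμsum, hμ₂, ← Finset.sum_sub_distrib]
    exact Finset.sum_pos (fun i _ => by nlinarith [hp i]) hne
  have hμ₂0 : 0 ≤ μ₂ := hμ₂ ▸ Finset.sum_nonneg fun i _ => sq_nonneg _
  have hfl : (a : ℝ) ≤ μ₂ := ha ▸ Int.floor_le μ₂
  have hμ0 : 0 < μ := by linarith
  have hlam0 : 0 < lam := by linarith
  have hk1 : 1 ≤ k := by
    have : (0 : ℝ) < k := hμ0.trans hk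
    exact_mod_cast this
  -- If `k = 1` then `μ₂ < μ < 1`, so the floor vanishes.
  have hka : 2 ≤ k ∨ a = 0 := by
    rcases hk1.eq_or_lt with h | h
    · right
      rw [ha, Int.floor_eq_zero_iff]
      rw [← h] at hk
      push_cast at hk
      exact ⟨hμ₂0, by linarith⟩
    · exact Or.inl h
  subst hW
  constructor
  · obtain ⟨f, hf, hfi⟩ := PoissonBinomial.exists_stein_solution hμ0 hk1
    have h1 := PoissonBinomial.tail_sub_eq hXm hX01 hXp hXindep (a := 0) (Or.inr rfl) hf
    have h2 := PoissonBinomial.abs_stein_one_le hp' hfi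
    simp only [sub_zero, Int.cast_zero, Polynomial.C_0, zero_mul, add_zero] at h1
    rw [← hμsum, ← h1, PoissonBinomial.Fbar_mul_C1 hμ0 hk1, ← hμ₂, mul_assoc] at h2
    exact PoissonBinomial.abs_div_sub_one_le (PoissonBinomial.Fbar_pos hμ0 (by omega)) h2
  · obtain ⟨f, hf, hfi⟩ := PoissonBinomial.exists_stein_solution hlam0 hk1
    have h1 := PoissonBinomial.tail_sub_eq hXm hX01 hXp hXindep hka hf
    have h2 := PoissonBinomial.abs_stein_two_le hp' (ψ := fun y => f (y - a))
      (fun y => by simpa only [add_sub_right_comm] using hfi (y - a)) a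
    rw [← hμsum, ← hlam, ← h1, PoissonBinomial.Fbar_mul_C1 hlam0 hk1, ← hμ₂] at h2
    refine (PoissonBinomial.abs_div_sub_one_le (PoissonBinomial.Fbar_pos hlam0 (by omega))
      (h2.trans_eq ?_)).trans (le_add_of_nonneg_right (Real.exp_nonneg _))
    have e : lam - σsq = μ₂ - a := by rw [hlam, hσ]; ring
    rw [e, PoissonBinomial.C2]
    ring
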